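/- Let $E: y^2=x^3+Ax+B$ with $A,B\in\mathbb{Z}$ be an elliptic curve with discriminant $\Delta(E)=-16(4A^3+27B^2)\neq 0$, and let $P=(a,b)\in E(\mathbb{Q})$ be a point of infinite order with integral coordinates $a,b\in\mathbb{Z}$. For $n\geq 1$ let $h_n=\psi_n(P)\in\mathbb{Z}$ be the value at $P$ of the $n$-th division polynomial of $E$, and write $x_{nP}=A_n/D_n^2$ in lowest terms, with $A_n, D_n\in\mathbb{Z}$ and $D_n>0$. For a prime $p$ let $E_0(\mathbb{Q}_p)\subseteq E(\mathbb{Q}_p)$ be the subgroup of points with nonsingular reduction on a minimal Weierstrass equation of $E$ over $\mathbb{Q}_p$, let $r(P,p)$ be the order of $P$ in $E(\mathbb{Q}_p)/E_0(\mathbb{Q}_p)$, and let $M=\operatorname{lcm}\{r(P,p) : p\text{ prime}\}$. Then for every $n\geq 1$, such $A_n, D_n$ exist, $h_n\neq 0$, and $$\log D_n\leq \log|h_n|\leq \log D_n+n^2M^2\log|\Delta(E)|.$$ -/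

import Mathlib

open scoped WeierstrassCurve

/-- The short Weierstrass equation `y² = x³ + Ax + B` with integral coefficients. -/
def shortWeierstrass (A B : ℤ) : WeierstrassCurve ℤ :=
  ⟨0, 0, 0, A, B⟩

/-- Let `W` be a minimal Weierstrass equation over `ℚ_p`. The point of `W` with affine coordinates
`(x, y)` has nonsingular reduction modulo `p` if it reduces to the point at infinity
(that is, `x` is not a `p`-adic integer), or if `x` and `y` are `p`-adic integers whose residues
are the coordinates of a nonsingular point of the reduced curve over the residue field. -/
def HasNonsingularReduction (p : ℕ) [Fact p.Prime] (W : WeierstrassCurve ℚ_[p])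
    [W.IsMinimal ℤ_[p]] (x y : ℚ_[p]) : Prop :=
  1 < ‖x‖ ∨ ∃ x₀ y₀ : ℤ_[p], x = x₀ ∧ y = y₀ ∧
    (W.reduction ℤ_[p]).toAffine.Nonsingular (IsLocalRing.residue ℤ_[p] x₀)
      (IsLocalRing.residue ℤ_[p] y₀)

/-- A point of an elliptic curve `W` over `ℚ_p` lies on the identity component if it is the point at
infinity, or if its image on a minimal Weierstrass equation `C • W` of `W` has nonsingular reduction
modulo `p`. Here `C = (u, r, s, t)` is a change of variables taking the point `(x', y')` of `C • W`
to the point `(u²x' + r, u³y' + u²sx' + t)` of `W`; the condition does not depend on `C`. -/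
def OnIdentityComponent (p : ℕ) [Fact p.Prime] (W : WeierstrassCurve ℚ_[p]) :
    W.toAffine.Point → Prop
  | .zero => True
  | .some x y _ => ∃ (C : WeierstrassCurve.VariableChange ℚ_[p])
      (_ : (C • W).IsMinimal ℤ_[p]) (x' y' : ℚ_[p]),
      x = C.u ^ 2 * x' + C.r ∧ y = C.u ^ 3 * y' + C.u ^ 2 * C.s * x' + C.t ∧
      HasNonsingularReduction p (C • W) x' y'

open Classical in
/-- The subgroup `E₀(ℚ_p)` of `E(ℚ_p)`: the points on the identity component. These points already
form a subgroup, so the closure adds no further points. -/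
noncomputable def identityComponent (p : ℕ) [Fact p.Prime] (W : WeierstrassCurve ℚ_[p]) :
    AddSubgroup W.toAffine.Point :=
  AddSubgroup.closure {Q | OnIdentityComponent p W Q}

open Classical in
/-- `r(P, p)`: the order of (the image of) `P ∈ E(ℚ)` in the component group
`E(ℚ_p) / E₀(ℚ_p)`. -/
noncomputable def componentOrder (W : WeierstrassCurve ℤ) (P : (W⁄ℚ).toAffine.Point)
    (p : ℕ) [Fact p.Prime] : ℕ :=
  addOrderOf (QuotientAddGroup.mk
    (WeierstrassCurve.Affine.Point.baseChange (W' := W) ℚ ℚ_[p] P) :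
      (W⁄ℚ_[p]).toAffine.Point ⧸ identityComponent p (W⁄ℚ_[p]))

/-- `M(P)`: the least common multiple, over all primes `p`, of the orders `r(P, p)`. -/
noncomputable def componentLcm (W : WeierstrassCurve ℤ) (P : (W⁄ℚ).toAffine.Point) : ℕ :=
  sInf {m : ℕ | 0 < m ∧ ∀ (p : ℕ) [Fact p.Prime], componentOrder W P p ∣ m}

/-- The point `Q` is affine and `x_Q = A / D²` in lowest terms, with `D > 0`. -/
def XCoordLowestTerms {W : WeierstrassCurve ℚ} (Q : W.toAffine.Point) (A D : ℤ) : Prop :=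
  0 < D ∧ IsCoprime A D ∧
    ∃ (x y : ℚ) (h : W.toAffine.Nonsingular x y), Q = .some x y h ∧ x = A / (D : ℚ) ^ 2

/-- The value `h_n = ψ_n(P)` of the `n`-th division polynomial at the integral point
`P = (a, b)`. -/
noncomputable def divisionValue (W : WeierstrassCurve ℤ) (a b : ℤ) (n : ℕ) : ℤ :=
  (W.ψ n).evalEval a b

/-!
Write `xₙ` for the `x`-coordinate of `nP` and `hₙ = ψₙ(P)`. The theorem is a statement about the
cancellation `qₙ = hₙ² / den xₙ`, because `den xₙ = Dₙ²`: it says `1 ≤ qₙ ≤ |Δ| ^ (2n²M²)`.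

Division polynomials and multiples of `P`. The product `(X - x(Q + R)) (X - x(Q - R))`, multiplied by
`(x(Q) - x(R))²`, is a form in `X, x(Q), x(R)` that is symmetric in all three arguments
(`xCoord_add_sub`, `biquadraticForm_swap`). Define `kₙ` by `kₙ₊₁ kₙ₋₁ = (x₁ - xₙ) kₙ²`. The symmetry
gives `kₘ₊ₙ kₘ₋ₙ = (xₙ - xₘ) kₘ² kₙ²` (`sequenceOfXCoords_add_mul_sub`), which contains the recursion
of the division polynomials, so `kₙ = hₙ` (`cast_divisionValue_eq_sequenceOfXCoords`). Hence `hₙ ≠ 0`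
and `xₙ hₙ² = a hₙ² - hₙ₊₁ hₙ₋₁` is an integer, so that `qₙ` is a positive integer.

Bounding the cancellation. By Gauss's lemma `qₙ₊₁ qₙ₋₁ = t qₙ²`, where `t` is the greatest common
divisor of the three coefficients of the form above with `Q = nP` and `R = P`, cleared of
denominators. A resultant identity shows that `t` divides `N²` with `N = 4(4A³ + 27B²)`
(`mul_dvd_sq_mul_sq`). With `q₁ = 1` and `q₂ ∣ N` this yields `qₙ ≤ |N| ^ n²`
(`den_le_sq_and_sq_le`). Since `|Δ| = 4 |N|`, this suffices as soon as `M ≥ 1`.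

Positivity of `M`. For `p ∤ Δ` the given equation is minimal with good reduction, so `r(P, p) = 1`.
For the other primes local compactness of `ℚ_p` provides multiples of `P` so close to infinity that
they reduce to infinity on a minimal model, so `r(P, p)` is finite. Hence the common multiples exist
(`componentLcm_pos`).
-/

/-! ### The biquadratic form of a short Weierstrass equation -/

section Biquadratic

variable {R : Type*} [CommRing R]

/-- The symmetric form in three `x`-coordinates attached to `y² = x³ + Ax + B`. As a
polynomial in `x` it has the roots `x(Q + R)` and `x(Q - R)`, where `y = x(Q)` and `z = x(R)`. -/
def biquadraticForm (A B x y z : R) : R :=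
  x ^ 2 * (y - z) ^ 2 - x * (2 * (y * z + A) * (y + z) + 4 * B) +
    ((y * z - A) ^ 2 - 4 * B * (y + z))

lemma biquadraticForm_swap (A B x y z : R) :
    biquadraticForm A B x y z = biquadraticForm A B y x z := by
  unfold biquadraticForm; ring

end Biquadratic

/-- The `x`-coordinate of a point, with the junk value `0` at infinity. -/
def WeierstrassCurve.Affine.Point.xCoord {K : Type*} [Field K] {W : WeierstrassCurve K} :
    W.toAffine.Point → K
  | .zero => 0
  | .some x _ _ => x

section GroupLaw

open WeierstrassCurve.Affine WeierstrassCurve.Affine.Point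

variable {K : Type*} [Field K] [DecidableEq K] {W : WeierstrassCurve K}

omit [DecidableEq K] in
lemma xCoord_ne_of_ne {P Q : W.toAffine.Point} (hP : P ≠ 0) (hQ : Q ≠ 0) (h : P ≠ Q)
    (h' : P ≠ -Q) : P.xCoord ≠ Q.xCoord := by
  rcases P with _ | ⟨x₁, y₁, h₁⟩
  · exact absurd rfl hP
  rcases Q with _ | ⟨x₂, y₂, h₂⟩
  · exact absurd rfl hQ
  intro hx
  exact (X_eq_iff.mp hx).elim h h'

lemma xCoord_add_sub (ha₁ : W.a₁ = 0) (ha₂ : W.a₂ = 0) (ha₃ : W.a₃ = 0)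
    {P Q : W.toAffine.Point} (hP : P ≠ 0) (hQ : Q ≠ 0) (h : P.xCoord ≠ Q.xCoord) (X : K) :
    (X - (P + Q).xCoord) * (X - (P - Q).xCoord) * (P.xCoord - Q.xCoord) ^ 2 =
      biquadraticForm W.a₄ W.a₆ X P.xCoord Q.xCoord := by
  rcases P with _ | ⟨x₁, y₁, h₁⟩
  · exact absurd rfl hP
  rcases Q with _ | ⟨x₂, y₂, h₂⟩
  · exact absurd rfl hQ
  have hx : x₁ ≠ x₂ := h
  have hx' : x₁ - x₂ ≠ 0 := sub_ne_zero.mpr hx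
  have e₁ := (equation_iff _ _).mp h₁.1
  have e₂ := (equation_iff _ _).mp h₂.1
  rw [sub_eq_add_neg (some x₁ y₁ h₁), neg_some, add_of_X_ne hx, add_of_X_ne hx]
  simp only [xCoord, addX, slope_of_X_ne hx, negY, ha₁, ha₂, ha₃, biquadraticForm] at e₁ e₂ ⊢
  field_simp
  have f₁ : y₁ ^ 2 = x₁ ^ 3 + W.a₄ * x₁ + W.a₆ := by linear_combination e₁
  have f₂ : y₂ ^ 2 = x₂ ^ 3 + W.a₄ * x₂ + W.a₆ := by linear_combination e₂
  have g : W.a₄ = (y₁ ^ 2 - y₂ ^ 2 - x₁ ^ 3 + x₂ ^ 3) / (x₁ - x₂) := by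
    rw [eq_div_iff hx']; linear_combination f₂ - f₁
  have g' : W.a₆ = y₁ ^ 2 - x₁ ^ 3 - W.a₄ * x₁ := by linear_combination - f₁
  rw [g', g]
  field_simp
  ring

lemma xCoord_two_nsmul (ha₁ : W.a₁ = 0) (ha₂ : W.a₂ = 0) (ha₃ : W.a₃ = 0)
    {x y : K} (h : W.toAffine.Nonsingular x y) (hy : 2 * y ≠ 0) (X : K) :
    4 * y ^ 2 * ((2 • some x y h).xCoord - X) = biquadraticForm W.a₄ W.a₆ X x x := by
  have e₁ := (equation_iff _ _).mp h.1
  have hy' : y ≠ W.toAffine.negY x y := by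
    simp only [negY, ha₁, ha₃]; intro hh; apply hy; linear_combination hh
  rw [two_nsmul, add_self_of_Y_ne hy']
  simp only [xCoord, addX, slope_of_Y_ne rfl hy']
  simp only [negY, ha₁, ha₂, ha₃, biquadraticForm] at e₁ ⊢
  have g' : W.a₆ = y ^ 2 - x ^ 3 - W.a₄ * x := by linear_combination -e₁
  have hy₀ : y ≠ 0 := right_ne_zero_of_mul hy
  have h₂ : (2 : K) ≠ 0 := left_ne_zero_of_mul hy
  rw [g', show y - (-y - 0 * x - 0) = 2 * y by ring]
  field_simp
  ring

end GroupLaw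

/-! ### The elliptic divisibility sequence of a point -/

section Sequence

variable {K : Type*} [Field K]

/-- The properties of the `x`-coordinates `xₙ = x(nP)` of the multiples of a point `P = (x₁, β)` of
infinite order on `y² = x³ + Ax + B` that determine the division polynomials at `P`. The value `x₀`
plays no role. -/
structure IsXCoordSequence (A B β : K) (x : ℕ → K) : Prop where
  ne : ∀ i j, 1 ≤ i → 1 ≤ j → i ≠ j → x i ≠ x j
  two_mul_ne_zero : 2 * β ≠ 0
  equation : β ^ 2 = x 1 ^ 3 + A * x 1 + B
  add : ∀ n X, (X - x (n + 3)) * (X - x (n + 1)) * (x (n + 2) - x 1) ^ 2 =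
    biquadraticForm A B X (x (n + 2)) (x 1)
  two : ∀ X, (2 * β) ^ 2 * (x 2 - X) = biquadraticForm A B X (x 1) (x 1)

/-- The sequence determined by `k₀ = 0`, `k₁ = 1`, `k₂ = c` and
`kₙ₊₁ kₙ₋₁ = (x₁ - xₙ) kₙ²`. -/
def sequenceOfXCoords (x : ℕ → K) (c : K) : ℕ → K
  | 0 => 0
  | 1 => 1
  | 2 => c
  | n + 3 => (x 1 - x (n + 2)) * sequenceOfXCoords x c (n + 2) ^ 2 / sequenceOfXCoords x c (n + 1)

variable {x : ℕ → K} {A B β : K}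

local notation "k" => sequenceOfXCoords x (2 * β)

lemma sequenceOfXCoords_ne_zero (hx : IsXCoordSequence A B β x) : ∀ n, 1 ≤ n → k n ≠ 0
  | 0 => fun h => absurd h (by norm_num)
  | 1 => fun _ => by simp [sequenceOfXCoords]
  | 2 => fun _ => by simpa [sequenceOfXCoords] using hx.two_mul_ne_zero
  | n + 3 => fun _ => by
    rw [sequenceOfXCoords]
    exact div_ne_zero (mul_ne_zero
      (sub_ne_zero.mpr (hx.ne _ _ le_rfl (by omega) (by omega)))
      (pow_ne_zero _ (sequenceOfXCoords_ne_zero hx (n + 2) (by omega))))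
      (sequenceOfXCoords_ne_zero hx (n + 1) (by omega))

lemma sequenceOfXCoords_mul (hx : IsXCoordSequence A B β x) (n : ℕ) :
    k (n + 2) * k n = (x 1 - x (n + 1)) * k (n + 1) ^ 2 := by
  rcases n with _ | n
  · simp [sequenceOfXCoords]
  · rw [sequenceOfXCoords, div_mul_cancel₀]
    exact sequenceOfXCoords_ne_zero hx _ (by omega)

/-- The relation `(xₙ - xₘ) kₘ² kₙ² = kₘ₊ₙ kₘ₋ₙ` for `m = n + d`. The induction step multiplies the
relations for `(m, n + 1)` and `(m, n - 1)` and compares with those for `(m + 1, n)` and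
`(m - 1, n)`; the two products agree by the symmetry of the biquadratic form. -/
lemma sequenceOfXCoords_add_mul_sub (hx : IsXCoordSequence A B β x) (n d : ℕ) :
    k (2 * (n + 1) + d) * k d =
      (x (n + 1) - x (n + 1 + d)) * k (n + 1 + d) ^ 2 * k (n + 1) ^ 2 := by
  have hk := sequenceOfXCoords_ne_zero hx
  have hr := sequenceOfXCoords_mul hx
  induction n using Nat.strong_induction_on generalizing d with
  | _ n ih =>
  rcases n with _ | _ | n
  · rw [show 2 * (0 + 1) + d = d + 2 by ring, show 0 + 1 + d = d + 1 by ring, hr d]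
    simp [sequenceOfXCoords]
  · have h₁ := hr (d + 2)
    have h₂ := hr d
    have h₃ := hr (d + 1)
    have h₄ := hx.add d (x 1)
    rw [biquadraticForm_swap, ← hx.two] at h₄
    have hne := hk (d + 2) (by omega)
    rw [show 2 * (0 + 1 + 1) + d = d + 2 + 2 by ring, show 0 + 1 + 1 + d = d + 2 by ring]
    simp only [add_assoc, Nat.reduceAdd] at h₁ h₂ h₃ h₄ ⊢
    have h2 : k 2 = 2 * β := by simp [sequenceOfXCoords]
    rw [h2]
    apply mul_right_cancel₀ (pow_ne_zero 2 hne)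
    calc k (d + 4) * k d * k (d + 2) ^ 2
        = (k (d + 4) * k (d + 2)) * (k (d + 2) * k d) := by ring
      _ = (x 1 - x (d + 3)) * (x 1 - x (d + 1)) * (k (d + 3) * k (d + 1)) ^ 2 := by
          rw [h₁, h₂]; ring
      _ = (x 1 - x (d + 3)) * (x 1 - x (d + 1)) * (x (d + 2) - x 1) ^ 2 * k (d + 2) ^ 4 := by
          rw [h₃]; ring
      _ = _ := by rw [h₄]; ring
  · rcases d with _ | d
    · simp [sequenceOfXCoords]
    have t₁ : k (2 * n + d + 5) * k (d + 3) =
        (x (n + 1) - x (n + d + 4)) * k (n + d + 4) ^ 2 * k (n + 1) ^ 2 := by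
      have := ih n (by omega) (d + 3)
      rwa [show 2 * (n + 1) + (d + 3) = 2 * n + d + 5 by ring,
        show n + 1 + (d + 3) = n + d + 4 by ring] at this
    have t₂ : k (2 * n + d + 7) * k (d + 3) =
        (x (n + 2) - x (n + d + 5)) * k (n + d + 5) ^ 2 * k (n + 2) ^ 2 := by
      have := ih (n + 1) (by omega) (d + 3)
      rwa [show 2 * (n + 1 + 1) + (d + 3) = 2 * n + d + 7 by ring,
        show n + 1 + 1 + (d + 3) = n + d + 5 by ring] at this
    have t₃ : k (2 * n + d + 5) * k (d + 1) =
        (x (n + 2) - x (n + d + 3)) * k (n + d + 3) ^ 2 * k (n + 2) ^ 2 := by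
      have := ih (n + 1) (by omega) (d + 1)
      rwa [show 2 * (n + 1 + 1) + (d + 1) = 2 * n + d + 5 by ring,
        show n + 1 + 1 + (d + 1) = n + d + 3 by ring] at this
    have h₁ := hr (n + 1)
    have h₂ := hr (n + d + 3)
    have h₃ := hx.add n (x (n + d + 4))
    have h₄ := hx.add (n + d + 2) (x (n + 2))
    rw [biquadraticForm_swap, ← h₃] at h₄
    have hne₁ := hk (n + 1) (by omega)
    have hne₂ := hk (d + 3) (by omega)
    have hne₃ := hk (2 * n + d + 5) (by omega)
    rw [show 2 * (n + 1 + 1 + 1) + (d + 1) = 2 * n + d + 7 by ring,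
      show n + 1 + 1 + 1 + (d + 1) = n + d + 4 by ring]
    simp only [add_assoc, Nat.reduceAdd] at t₁ t₂ t₃ h₁ h₂ h₄ hne₁ hne₂ hne₃ ⊢
    apply mul_right_cancel₀ (mul_ne_zero hne₃ hne₂)
    calc k (2 * n + (d + 7)) * k (d + 1) * (k (2 * n + (d + 5)) * k (d + 3))
        = (k (2 * n + (d + 7)) * k (d + 3)) * (k (2 * n + (d + 5)) * k (d + 1)) := by ring
      _ = (x (n + 2) - x (n + (d + 5))) * (x (n + 2) - x (n + (d + 3))) *
            (k (n + (d + 5)) * k (n + (d + 3))) ^ 2 * k (n + 2) ^ 4 := by rw [t₂, t₃]; ring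
      _ = ((x (n + 2) - x (n + (d + 5))) * (x (n + 2) - x (n + (d + 3))) *
            (x (n + (d + 4)) - x 1) ^ 2) * k (n + (d + 4)) ^ 4 * k (n + 2) ^ 4 := by
          rw [h₂]; ring
      _ = (x (n + (d + 4)) - x (n + 3)) * (x (n + (d + 4)) - x (n + 1)) *
            k (n + (d + 4)) ^ 4 * ((x 1 - x (n + 2)) * k (n + 2) ^ 2) ^ 2 := by rw [h₄]; ring
      _ = (x (n + 3) - x (n + (d + 4))) * k (n + (d + 4)) ^ 2 * k (n + 3) ^ 2 *
            ((x (n + 1) - x (n + (d + 4))) * k (n + (d + 4)) ^ 2 * k (n + 1) ^ 2) := by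
          rw [← h₁]; ring
      _ = _ := by rw [t₁]

/-- The recursion of a normalized elliptic divisibility sequence is the case `m - n ∈ {1, 2}` of the
relation `(xₙ - xₘ) kₘ² kₙ² = kₘ₊ₙ kₘ₋ₙ`. -/
lemma sequenceOfXCoords_eq_normEDS_of_initial {c d : K}
    (hx : IsXCoordSequence A B β x) (h3 : k 3 = c) (h4 : k 4 = d * (2 * β)) (n : ℕ) :
    k n = normEDS (2 * β) c d n := by
  have hr := sequenceOfXCoords_mul hx
  have ht := sequenceOfXCoords_add_mul_sub hx
  have k0 : k 0 = 0 := by simp [sequenceOfXCoords]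
  have k1 : k 1 = 1 := by simp [sequenceOfXCoords]
  have k2 : k 2 = 2 * β := by simp [sequenceOfXCoords]
  induction n using Nat.strong_induction_on with
  | _ n ih =>
  rcases Nat.even_or_odd' n with ⟨m, rfl | rfl⟩
  · rcases m with _ | _ | _ | m
    · simp [k0]
    · simp [k2]
    · simp [h4]
    · apply mul_right_cancel₀ hx.two_mul_ne_zero
      have t := ht (m + 1) 2
      have h₁ := hr (m + 1)
      have h₂ := hr (m + 3)
      have e := normEDS_even (2 * β) c d (m + 3)
      have i₁ := ih (m + 1) (by omega)
      have i₂ := ih (m + 2) (by omega)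
      have i₃ := ih (m + 3) (by omega)
      have i₄ := ih (m + 4) (by omega)
      have i₅ := ih (m + 5) (by omega)
      push_cast at i₁ i₂ i₃ i₄ i₅ ⊢
      rw [show (m : ℤ) + 3 - 1 = m + 2 by ring, show (m : ℤ) + 3 + 2 = m + 5 by ring,
        show (m : ℤ) + 3 - 2 = m + 1 by ring, show (m : ℤ) + 3 + 1 = m + 4 by ring,
        ← i₁, ← i₂, ← i₃, ← i₄, ← i₅] at e
      rw [show (m : ℤ) + 1 + 1 + 1 = m + 3 by ring, e]
      rw [show 2 * (m + 1 + 1) + 2 = 2 * (m + 3) by ring, k2] at t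
      rw [show m + 1 + 1 + 1 = m + 3 by ring, t]
      simp only [add_assoc, Nat.reduceAdd] at h₁ h₂ ⊢
      linear_combination k (m + 4) ^ 2 * h₁ - k (m + 2) ^ 2 * h₂
  · rcases m with _ | _ | m
    · simp [k1]
    · simp [h3]
    · have t := ht (m + 1) 1
      have h₁ := hr (m + 1)
      have h₂ := hr (m + 2)
      have e := normEDS_odd (2 * β) c d (m + 2)
      have i₁ := ih (m + 1) (by omega)
      have i₂ := ih (m + 2) (by omega)
      have i₃ := ih (m + 3) (by omega)
      have i₄ := ih (m + 4) (by omega)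
      push_cast at i₁ i₂ i₃ i₄ ⊢
      rw [show (m : ℤ) + 2 - 1 = m + 1 by ring, show (m : ℤ) + 2 + 2 = m + 4 by ring,
        show (m : ℤ) + 2 + 1 = m + 3 by ring, ← i₁, ← i₂, ← i₃, ← i₄] at e
      rw [show (m : ℤ) + 1 + 1 = m + 2 by ring, e]
      rw [k1, mul_one] at t
      rw [show m + 1 + 1 = m + 2 by ring, t]
      simp only [add_assoc, Nat.reduceAdd] at h₁ h₂ ⊢
      linear_combination k (m + 3) ^ 2 * h₁ - k (m + 2) ^ 2 * h₂

/-- The sequence is the normalized elliptic divisibility sequence whose initial values are those of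
the division polynomials of `y² = x³ + Ax + B` at `(x₁, β)`. -/
lemma sequenceOfXCoords_eq_normEDS (hx : IsXCoordSequence A B β x) (n : ℕ) :
    k n = normEDS (2 * β) (3 * x 1 ^ 4 + 6 * A * x 1 ^ 2 + 12 * B * x 1 - A ^ 2)
      (2 * x 1 ^ 6 + 10 * A * x 1 ^ 4 + 40 * B * x 1 ^ 3 - 10 * A ^ 2 * x 1 ^ 2
        - 8 * A * B * x 1 - 2 * A ^ 3 - 16 * B ^ 2) n := by
  refine sequenceOfXCoords_eq_normEDS_of_initial hx ?_ ?_ n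
  all_goals
    have hr := sequenceOfXCoords_mul hx
    have k1 : k 1 = 1 := by simp [sequenceOfXCoords]
    have k2 : k 2 = 2 * β := by simp [sequenceOfXCoords]
    have k3 : k 3 = (x 1 - x 2) * (2 * β) ^ 2 := by simpa [k1, k2] using hr 1
  · have h := hx.two (x 1)
    simp only [biquadraticForm] at h
    linear_combination k3 - h
  · have h := hx.two 0
    -- At `X = x₁ + 1` the factor `X - x₁` is `1`, which leaves a linear equation for `x₃`.
    have h₁ := hx.add 0 (x 1 + 1)
    have h' := hr 2
    simp only [Nat.reduceAdd, zero_add, k2, k3] at h' h₁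
    have hβ₀ : β ≠ 0 := right_ne_zero_of_mul hx.two_mul_ne_zero
    have h₂ : (2 : K) ≠ 0 := left_ne_zero_of_mul hx.two_mul_ne_zero
    have hB : B = β ^ 2 - x 1 ^ 3 - A * x 1 := by linear_combination -hx.equation
    have hx₂ : x 2 = ((x 1 ^ 2 - A) ^ 2 - 8 * B * x 1) / (2 * β) ^ 2 := by
      rw [eq_div_iff (pow_ne_zero 2 hx.two_mul_ne_zero)]
      simp only [biquadraticForm] at h
      linear_combination h
    apply mul_right_cancel₀ hx.two_mul_ne_zero
    have e : k 4 * (2 * β) =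
        (biquadraticForm A B (x 1 + 1) (x 2) (x 1) - (x 2 - x 1) ^ 2) * (2 * β) ^ 4 := by
      linear_combination h' + (2 * β) ^ 4 * h₁
    rw [e, hx₂, hB]
    simp only [biquadraticForm]
    field_simp
    ring

end Sequence

/-! ### Multiples of a point of infinite order -/

section Multiples

open WeierstrassCurve.Affine WeierstrassCurve.Affine.Point

variable {K : Type*} [Field K] [DecidableEq K] {W : WeierstrassCurve K}

lemma nsmul_ne_zero_of_not_isOfFinAddOrder {G : Type*} [AddMonoid G] {P : G}
    (hinf : ¬ IsOfFinAddOrder P) (n : ℕ) (hn : 1 ≤ n) : n • P ≠ 0 := fun h0 =>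
  hinf (isOfFinAddOrder_iff_nsmul_eq_zero.mpr ⟨n, hn, h0⟩)

lemma xCoord_nsmul_ne {P : W.toAffine.Point} (hinf : ¬ IsOfFinAddOrder P) {i j : ℕ} (hi : 1 ≤ i)
    (hj : 1 ≤ j) (hij : i ≠ j) : (i • P).xCoord ≠ (j • P).xCoord := by
  have hmul := nsmul_ne_zero_of_not_isOfFinAddOrder hinf
  refine xCoord_ne_of_ne (hmul i hi) (hmul j hj)
    (fun e => hij (injective_nsmul_iff_not_isOfFinAddOrder.mpr hinf e)) fun e => ?_
  refine hmul (i + j) (by omega) ?_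
  rw [add_nsmul, e, neg_add_cancel]

lemma isXCoordSequence_nsmul (ha₁ : W.a₁ = 0) (ha₂ : W.a₂ = 0) (ha₃ : W.a₃ = 0) {a b : K}
    (h : W.toAffine.Nonsingular a b) (hinf : ¬ IsOfFinAddOrder (some a b h)) :
    IsXCoordSequence W.a₄ W.a₆ b fun n => (n • some a b h).xCoord := by
  set P := some a b h with hP
  have hmul := nsmul_ne_zero_of_not_isOfFinAddOrder hinf
  have hne := fun i j => xCoord_nsmul_ne (i := i) (j := j) hinf
  have h2 : 2 * b ≠ 0 := fun hb => by
    refine hmul 2 (by norm_num) ?_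
    rw [two_nsmul, hP, add_self_of_Y_eq]
    simp only [negY, ha₁, ha₃]
    linear_combination hb
  refine ⟨hne, h2, ?_, fun n X => ?_, fun X => ?_⟩
  · have e := (equation_iff _ _).mp h.1
    simp only [ha₁, ha₂, ha₃] at e
    simp only [one_nsmul, hP, xCoord]
    linear_combination e
  · have e := xCoord_add_sub ha₁ ha₂ ha₃ (hmul (n + 2) (by omega)) (hmul 1 le_rfl)
      (hne _ _ (by omega) le_rfl (by omega)) X
    rwa [← add_nsmul, show (n + 2) • P - 1 • P = (n + 1) • P by
      rw [sub_eq_iff_eq_add, ← add_nsmul]] at e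
  · have e := xCoord_two_nsmul ha₁ ha₂ ha₃ h h2 X
    rw [one_nsmul]
    change _ = biquadraticForm W.a₄ W.a₆ X a a
    rw [← e]
    ring

end Multiples

lemma divisionValue_shortWeierstrass (A B a b : ℤ) (n : ℕ) :
    divisionValue (shortWeierstrass A B) a b n =
      normEDS (2 * b) (3 * a ^ 4 + 6 * A * a ^ 2 + 12 * B * a - A ^ 2)
        (2 * a ^ 6 + 10 * A * a ^ 4 + 40 * B * a ^ 3 - 10 * A ^ 2 * a ^ 2
          - 8 * A * B * a - 2 * A ^ 3 - 16 * B ^ 2) n := by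
  rw [divisionValue, WeierstrassCurve.ψ, ← Polynomial.coe_evalEvalRingHom, map_normEDS]
  congr 1
  · simp [WeierstrassCurve.ψ₂, WeierstrassCurve.Affine.polynomialY, shortWeierstrass]
  · simp only [WeierstrassCurve.Ψ₃, WeierstrassCurve.b₂, WeierstrassCurve.b₄,
      WeierstrassCurve.b₆, WeierstrassCurve.b₈, shortWeierstrass, Polynomial.coe_evalEvalRingHom,
      Polynomial.evalEval_C]
    simp
    ring
  · simp only [WeierstrassCurve.preΨ₄, WeierstrassCurve.b₂, WeierstrassCurve.b₄,
      WeierstrassCurve.b₆, WeierstrassCurve.b₈, shortWeierstrass, Polynomial.coe_evalEvalRingHom,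
      Polynomial.evalEval_C]
    simp
    ring

lemma cast_divisionValue_eq_sequenceOfXCoords {A B a b : ℤ} {x : ℕ → ℚ}
    (hx : IsXCoordSequence (A : ℚ) B b x) (ha : x 1 = a) (n : ℕ) :
    (divisionValue (shortWeierstrass A B) a b n : ℚ) = sequenceOfXCoords x (2 * (b : ℚ)) n := by
  rw [sequenceOfXCoords_eq_normEDS hx, divisionValue_shortWeierstrass, ha, ← eq_intCast
    (Int.castRingHom ℚ), map_normEDS]
  simp

/-! ### Cancellation between numerator and denominator -/

/-- If two fractions `P / E` and `p / e` in lowest terms have sum `S / U` and product `T / U`, then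
`U` is a multiple `t E e` of the product of the denominators. This is Gauss's lemma for the product
of the two primitive linear forms `E X - P` and `e X - p`. -/
lemma mul_dvd_of_sum_of_prod {R : Type*} [CommRing R] {P E p e U S T : R} (h₁ : IsCoprime P E)
    (h₂ : IsCoprime p e) (hS : U * (P * e + p * E) = S * (E * e)) (hT : U * (P * p) = T * (E * e)) :
    E * e ∣ U := by
  obtain ⟨α, β, h₁⟩ := h₁
  obtain ⟨γ, δ, h₂⟩ := h₂
  -- `P e` satisfies `(P e)² = (P e)(P e + p E) - (P p)(E e)`, so it is nilpotent modulo the ideal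
  -- generated by the three coefficients `d`, `s`, `t`.
  set t := P * p
  set d := E * e
  set s := P * e + p * E
  set w := P * e
  set c := α * δ - β * γ
  set i := α * γ * t + β * δ * d + β * γ * s
  have key : 1 = i * (i + 2 * c * w) + c ^ 2 * (w * s - t * d) := by
    linear_combination (-(α * P + β * E) * (γ * p + δ * e) - 1) *
      ((γ * p + δ * e) * h₁ + h₂)
  refine ⟨(α * γ * T + β * δ * U + β * γ * S) * (i + 2 * c * w) + c ^ 2 * (w * S - t * U), ?_⟩
  linear_combination U * key + (α * γ * hT + β * γ * hS) * (i + 2 * c * w) + c ^ 2 * w * hS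

/-- Modulo `(X - aZ)²` the two remaining coefficients of the biquadratic form are dual numbers with
constant terms `(a² - A)² - 8aB` and `4(a³ + Aa + B)`, whose resultant is a multiple of the
discriminant. -/
lemma dvd_sq_of_dvd_coeff {A B a X Z t : ℤ} (hXZ : IsCoprime X Z) (hU : t ∣ (X - a * Z) ^ 2)
    (hS : t ∣ 2 * (a * X + A * Z) * (X + a * Z) + 4 * B * Z ^ 2)
    (hT : t ∣ (a * X - A * Z) ^ 2 - 4 * B * Z * (X + a * Z)) :
    t ∣ (4 * (4 * A ^ 3 + 27 * B ^ 2)) ^ 2 := by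
  have hcop : IsCoprime t (Z ^ 3) := by
    refine (IsCoprime.pow_right ?_)
    refine IsCoprime.of_isCoprime_of_dvd_left (IsCoprime.pow_left ?_) hU
    have := hXZ.add_mul_right_left (-a)
    rwa [show X + -a * Z = X - a * Z by ring] at this
  refine hcop.dvd_of_dvd_mul_right ?_
  set N := 4 * (4 * A ^ 3 + 27 * B ^ 2)
  set α := 4 * (3 * a ^ 2 + 4 * A)
  set β := -(3 * a ^ 3 - 5 * A * a - 27 * B)
  set s := α * (2 * a ^ 3 - 2 * a * A - 4 * B) + β * (6 * a ^ 2 + 2 * A)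
  have key : N ^ 2 * Z ^ 3 =
      (α * ((a * X - A * Z) ^ 2 - 4 * B * Z * (X + a * Z)) +
        β * (2 * (a * X + A * Z) * (X + a * Z) + 4 * B * Z ^ 2)) * (N * Z - s * (X - a * Z)) +
      (X - a * Z) ^ 2 * (s ^ 2 * Z - (α * a ^ 2 + 2 * a * β) * (N * Z - s * (X - a * Z))) := by
    ring
  rw [key]
  exact (((hT.mul_left _).add (hS.mul_left _)).mul_right _).add (hU.mul_right _)

/-- The numerator and the denominator in the duplication formula have a multiple of the discriminant
as resultant. -/
lemma dvd_of_dvd_double {A B a t : ℤ} (hG : t ∣ 4 * (a ^ 3 + A * a + B))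
    (hF : t ∣ (a ^ 2 - A) ^ 2 - 8 * B * a) : t ∣ 4 * (4 * A ^ 3 + 27 * B ^ 2) := by
  have key : 4 * (4 * A ^ 3 + 27 * B ^ 2) =
      4 * (3 * a ^ 2 + 4 * A) * ((a ^ 2 - A) ^ 2 - 8 * B * a) -
      (3 * a ^ 3 - 5 * A * a - 27 * B) * (4 * (a ^ 3 + A * a + B)) := by ring
  rw [key]
  exact (hF.mul_left _).sub (hG.mul_left _)

section Cancellation

variable {A B a b : ℤ} {x : ℕ → ℚ} {h : ℕ → ℤ}

/-- Since `xₙ hₙ² = a hₙ² - hₙ₊₁ hₙ₋₁` is an integer, the denominator of `xₙ` divides `hₙ²`. -/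
lemma exists_sq_eq_mul_den (hx : IsXCoordSequence (A : ℚ) B b x) (ha : x 1 = a)
    (hh : ∀ n, (h n : ℚ) = sequenceOfXCoords x (2 * (b : ℚ)) n) (n : ℕ) :
    ∃ q : ℤ, 0 < q ∧ h (n + 1) ^ 2 = q * (x (n + 1)).den := by
  have hr := sequenceOfXCoords_mul hx n
  rw [← hh, ← hh, ← hh, ha] at hr
  have hne : h (n + 1) ≠ 0 := by
    have := sequenceOfXCoords_ne_zero hx (n + 1) (by omega)
    rw [← hh] at this
    exact_mod_cast this
  have hden : ((x (n + 1)).den : ℚ) ≠ 0 := by exact_mod_cast (x (n + 1)).den_ne_zero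
  have hnum := Rat.num_div_den (x (n + 1))
  have hz : (x (n + 1)).num * h (n + 1) ^ 2 =
      (a * h (n + 1) ^ 2 - h (n + 2) * h n) * (x (n + 1)).den := by
    have : ((x (n + 1)).num : ℚ) * h (n + 1) ^ 2 =
        (a * h (n + 1) ^ 2 - h (n + 2) * h n) * (x (n + 1)).den := by
      rw [hr]
      field_simp at hnum
      rw [hnum]
      ring
    exact_mod_cast this
  have hcop : IsCoprime ((x (n + 1)).den : ℤ) (x (n + 1)).num :=
    (Rat.isCoprime_num_den _).symm
  obtain ⟨q, hq⟩ := hcop.dvd_of_dvd_mul_left (Dvd.intro_left _ hz.symm)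
  refine ⟨q, ?_, by rw [hq]; ring⟩
  have h₁ : 0 < h (n + 1) ^ 2 := by positivity
  have h₂ : (0 : ℤ) < (x (n + 1)).den := by exact_mod_cast (x (n + 1)).pos
  rw [hq] at h₁
  exact pos_of_mul_pos_right h₁ h₂.le

/-- The cancellations `qₙ = hₙ² / den xₙ` satisfy `qₙ₊₁ qₙ₋₁ ∣ N² qₙ²`, where
`N = 4(4A³ + 27B²)`. -/
lemma mul_dvd_sq_mul_sq (hx : IsXCoordSequence (A : ℚ) B b x) (ha : x 1 = a)
    (hh : ∀ n, (h n : ℚ) = sequenceOfXCoords x (2 * (b : ℚ)) n) {n : ℕ} {q₁ q₂ q₃ : ℤ}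
    (e₁ : h (n + 1) ^ 2 = q₁ * (x (n + 1)).den) (e₂ : h (n + 2) ^ 2 = q₂ * (x (n + 2)).den)
    (e₃ : h (n + 3) ^ 2 = q₃ * (x (n + 3)).den) :
    q₃ * q₁ ∣ (4 * (4 * A ^ 3 + 27 * B ^ 2)) ^ 2 * q₂ ^ 2 := by
  have hr := sequenceOfXCoords_mul hx (n + 1)
  simp only [add_assoc, Nat.reduceAdd] at hr
  rw [← hh, ← hh, ← hh, ha] at hr
  have h₀ := hx.add n 0
  have h₁ := hx.add n 1
  rw [ha] at h₀ h₁
  have hX := Rat.num_div_den (x (n + 2))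
  have hP := Rat.num_div_den (x (n + 1))
  have hp := Rat.num_div_den (x (n + 3))
  have cX := Rat.isCoprime_num_den (x (n + 2))
  have cP := Rat.isCoprime_num_den (x (n + 1))
  have cp := Rat.isCoprime_num_den (x (n + 3))
  have dX := (x (n + 2)).den_ne_zero
  have dP := (x (n + 1)).den_ne_zero
  have dp := (x (n + 3)).den_ne_zero
  rw [← hX, ← hP, ← hp] at h₀ h₁
  rw [← hX] at hr
  set X := (x (n + 2)).num
  set P := (x (n + 1)).num
  set p := (x (n + 3)).num
  obtain ⟨Z, hZ⟩ : ∃ Z : ℤ, Z = (x (n + 2)).den := ⟨_, rfl⟩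
  obtain ⟨E, hE⟩ : ∃ E : ℤ, E = (x (n + 1)).den := ⟨_, rfl⟩
  obtain ⟨e, he⟩ : ∃ e : ℤ, e = (x (n + 3)).den := ⟨_, rfl⟩
  rw [← hZ] at e₂ cX
  rw [← hE] at e₁ cP
  rw [← he] at e₃ cp
  have hZ' : ((x (n + 2)).den : ℚ) = Z := by rw [hZ]; simp
  have hE' : ((x (n + 1)).den : ℚ) = E := by rw [hE]; simp
  have he' : ((x (n + 3)).den : ℚ) = e := by rw [he]; simp
  rw [hZ', hE', he'] at h₀ h₁
  rw [hZ'] at hr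
  have hZ0 : Z ≠ 0 := by rw [hZ]; exact_mod_cast dX
  have hE0 : E ≠ 0 := by rw [hE]; exact_mod_cast dP
  have he0 : e ≠ 0 := by rw [he]; exact_mod_cast dp
  have hZq : (Z : ℚ) ≠ 0 := by exact_mod_cast hZ0
  have hEq : (E : ℚ) ≠ 0 := by exact_mod_cast hE0
  have heq : (e : ℚ) ≠ 0 := by exact_mod_cast he0
  simp only [biquadraticForm] at h₀ h₁
  field_simp at h₀ h₁ hr
  have hT : (X - a * Z) ^ 2 * (P * p) =
      ((a * X - A * Z) ^ 2 - 4 * B * Z * (X + a * Z)) * (E * e) := by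
    have : ((X : ℚ) - a * Z) ^ 2 * (P * p) =
        ((a * X - A * Z) ^ 2 - 4 * B * Z * (X + a * Z)) * (E * e) := by
      linear_combination h₀
    exact_mod_cast this
  have hS : (X - a * Z) ^ 2 * (P * e + p * E) =
      (2 * (a * X + A * Z) * (X + a * Z) + 4 * B * Z ^ 2) * (E * e) := by
    have : ((X : ℚ) - a * Z) ^ 2 * (P * e + p * E) =
        (2 * (a * X + A * Z) * (X + a * Z) + 4 * B * Z ^ 2) * (E * e) := by
      linear_combination h₀ - h₁
    exact_mod_cast this
  have hr' : h (n + 3) * h (n + 1) * Z = (a * Z - X) * h (n + 2) ^ 2 := by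
    have : (h (n + 3) : ℚ) * h (n + 1) * Z = (a * Z - X) * h (n + 2) ^ 2 := by
      linear_combination hr
    exact_mod_cast this
  obtain ⟨t, ht⟩ := mul_dvd_of_sum_of_prod cP cp hS hT
  have hEe : E * e ≠ 0 := mul_ne_zero hE0 he0
  have htS : 2 * (a * X + A * Z) * (X + a * Z) + 4 * B * Z ^ 2 = t * (P * e + p * E) := by
    apply mul_right_cancel₀ hEe
    rw [← hS, ht]
    ring
  have htT : (a * X - A * Z) ^ 2 - 4 * B * Z * (X + a * Z) = t * (P * p) := by
    apply mul_right_cancel₀ hEe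
    rw [← hT, ht]
    ring
  have key : q₃ * q₁ = t * q₂ ^ 2 := by
    apply mul_right_cancel₀ (mul_ne_zero hEe (pow_ne_zero 2 hZ0))
    calc q₃ * q₁ * (E * e * Z ^ 2) = (q₃ * e) * (q₁ * E) * Z ^ 2 := by ring
      _ = (h (n + 3) * h (n + 1) * Z) ^ 2 := by rw [← e₃, ← e₁]; ring
      _ = (X - a * Z) ^ 2 * (h (n + 2) ^ 2) ^ 2 := by rw [hr']; ring
      _ = t * q₂ ^ 2 * (E * e * Z ^ 2) := by rw [ht, e₂]; ring
  rw [key]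
  refine mul_dvd_mul (dvd_sq_of_dvd_coeff (a := a) cX ?_ ?_ ?_) dvd_rfl
  · exact ⟨E * e, by rw [ht]; ring⟩
  · exact ⟨_, htS⟩
  · exact ⟨_, htT⟩

/-- The cancellation is at most `|N| ^ n²`: the estimate `qₙ₊₁ qₙ₋₁ ≤ N² qₙ²` says that the second
differences of `log qₙ` are at most `2 log |N|`. -/
lemma den_le_sq_and_sq_le (hN : 4 * (4 * A ^ 3 + 27 * B ^ 2) ≠ 0)
    (hx : IsXCoordSequence (A : ℚ) B b x) (ha : x 1 = a)
    (hh : ∀ n, (h n : ℚ) = sequenceOfXCoords x (2 * (b : ℚ)) n) (n : ℕ) :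
    ((x (n + 1)).den : ℤ) ≤ h (n + 1) ^ 2 ∧
      h (n + 1) ^ 2 ≤ |4 * (4 * A ^ 3 + 27 * B ^ 2)| ^ (n + 1) ^ 2 * (x (n + 1)).den := by
  choose q hq hqh using exists_sq_eq_mul_den hx ha hh
  have hmain := fun n => mul_dvd_sq_mul_sq hx ha hh (hqh n) (hqh (n + 1)) (hqh (n + 2))
  set N := 4 * (4 * A ^ 3 + 27 * B ^ 2) with hNdef
  have hN1 : 1 ≤ |N| := Int.one_le_abs hN
  have hden : ∀ n, (0 : ℤ) < (x n).den := fun n => by exact_mod_cast (x n).pos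
  have hh1 : h 1 = 1 := by
    have := hh 1
    simp only [sequenceOfXCoords] at this
    exact_mod_cast this
  have hh2 : h 2 = 2 * b := by
    have := hh 2
    simp only [sequenceOfXCoords] at this
    exact_mod_cast this
  have q0 : q 0 = 1 := by
    have e := hqh 0
    rw [zero_add, hh1, ha] at e
    simpa using e.symm
  have q1 : q 1 ∣ N := by
    have e := hqh 1
    simp only [Nat.reduceAdd] at e
    have e₁ := hx.equation
    rw [ha] at e₁
    have e₂ : b ^ 2 = a ^ 3 + A * a + B := by exact_mod_cast e₁
    have e₃ := hx.two 0
    have hnum := Rat.num_div_den (x 2)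
    have hd : ((x 2).den : ℚ) ≠ 0 := by exact_mod_cast (x 2).den_ne_zero
    field_simp at hnum
    have eq : (q 1 : ℚ) * (x 2).den = (2 * b) ^ 2 := by
      rw [hh2] at e
      exact_mod_cast e.symm
    refine dvd_of_dvd_double (a := a) ⟨(x 2).den, ?_⟩ ⟨(x 2).num, ?_⟩
    · rw [← e, hh2, ← e₂]; ring
    · have : ((a : ℚ) ^ 2 - A) ^ 2 - 8 * B * a = q 1 * (x 2).num := by
        simp only [biquadraticForm, ha] at e₃
        rw [hnum, ← eq] at *
        linear_combination -e₃
      exact_mod_cast this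
  have hstep : ∀ n, q (n + 1) ≤ |N| ^ (2 * (n + 1)) * q n := by
    intro n
    induction n with
    | zero =>
      have h₁ := Int.le_of_dvd (abs_pos.mpr hN) ((dvd_abs _ _).mpr q1)
      rw [q0, mul_one, zero_add]
      exact h₁.trans (le_self_pow₀ hN1 (by norm_num))
    | succ n ih =>
      have h₁ := Int.le_of_dvd (by have := hq (n + 1); positivity) (hmain n)
      refine le_of_mul_le_mul_right ?_ (hq n)
      calc q (n + 1 + 1) * q n ≤ N ^ 2 * q (n + 1) ^ 2 := h₁
        _ = |N| ^ 2 * q (n + 1) * q (n + 1) := by rw [sq_abs]; ring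
        _ ≤ |N| ^ 2 * q (n + 1) * (|N| ^ (2 * (n + 1)) * q n) :=
          mul_le_mul_of_nonneg_left ih (mul_nonneg (by positivity) (hq _).le)
        _ = |N| ^ (2 * (n + 1 + 1)) * q (n + 1) * q n := by ring
  have hbound : ∀ n, q n ≤ |N| ^ (n + 1) ^ 2 := by
    intro n
    induction n with
    | zero => rw [q0]; exact one_le_pow₀ hN1
    | succ n ih =>
      calc q (n + 1) ≤ |N| ^ (2 * (n + 1)) * q n := hstep n
        _ ≤ |N| ^ (2 * (n + 1)) * |N| ^ (n + 1) ^ 2 := by gcongr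
        _ = |N| ^ (2 * (n + 1) + (n + 1) ^ 2) := (pow_add _ _ _).symm
        _ ≤ |N| ^ (n + 1 + 1) ^ 2 := pow_le_pow_right₀ hN1 (by nlinarith)
  rw [hqh n]
  exact ⟨le_mul_of_one_le_left (hden _).le (hq n),
    mul_le_mul_of_nonneg_right (hbound n) (hden _).le⟩

end Cancellation

/-! ### The component groups -/

section Component

open WeierstrassCurve WeierstrassCurve.Affine WeierstrassCurve.Affine.Point

/-- A sequence in a locally compact field that satisfies the addition formula for `x`-coordinates is
unbounded: at an accumulation point `x₀` of a bounded one, `biquadraticForm A B X x₀ x₀` would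
vanish for all `X`. -/
lemma exists_lt_norm_of_biquadraticForm {K : Type*} [NormedField K] [ProperSpace K] {A B : K}
    (hΔ : 4 * (4 * A ^ 3 + 27 * B ^ 2) ≠ 0) {x : ℕ → K}
    (hadd : ∀ m n X, 1 ≤ n → n < m →
      (X - x (m + n)) * (X - x (m - n)) * (x m - x n) ^ 2 = biquadraticForm A B X (x m) (x n))
    (c : ℝ) : ∃ n : ℕ, 1 ≤ n ∧ c < ‖x n‖ := by
  by_contra! hc
  obtain ⟨x₀, -, φ, hφ, hlim⟩ := tendsto_subseq_of_bounded
    (Metric.isBounded_closedBall (x := (0 : K)) (r := c))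
    (x := fun n => x (n + 1)) (fun n => by simpa using hc (n + 1) (by omega))
  have hlim₁ : Filter.Tendsto (fun k => x (φ k + 1)) Filter.atTop (nhds x₀) := hlim
  have hlim₂ : Filter.Tendsto (fun k => x (φ (k + 1) + 1)) Filter.atTop (nhds x₀) :=
    (Filter.tendsto_add_atTop_iff_nat (f := fun k => x (φ k + 1)) 1).mpr hlim₁
  have hform : ∀ X, biquadraticForm A B X x₀ x₀ = 0 := by
    intro X
    have h₁ : Filter.Tendsto (fun k => biquadraticForm A B X (x (φ (k + 1) + 1)) (x (φ k + 1)))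
        Filter.atTop (nhds (biquadraticForm A B X x₀ x₀)) := by
      have hcont : Continuous fun z : K × K => biquadraticForm A B X z.1 z.2 := by
        unfold biquadraticForm; fun_prop
      have hp : Filter.Tendsto (fun k => (x (φ (k + 1) + 1), x (φ k + 1))) Filter.atTop
          (nhds (x₀, x₀)) := hlim₂.prodMk_nhds hlim₁
      have h := Filter.Tendsto.comp (hcont.tendsto (x₀, x₀)) hp
      simp only [Function.comp_def] at h
      exact h
    have hb : ∀ n, 1 ≤ n → ‖X - x n‖ ≤ ‖X‖ + c := fun n hn =>
      (norm_sub_le X _).trans (by linarith [hc n hn])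
    have hc₀ : 0 ≤ ‖X‖ + c := (norm_nonneg _).trans (hb 1 le_rfl)
    have h₂ : ∀ k, ‖biquadraticForm A B X (x (φ (k + 1) + 1)) (x (φ k + 1))‖ ≤
        (‖X‖ + c) * (‖X‖ + c) * ‖x (φ (k + 1) + 1) - x (φ k + 1)‖ ^ 2 := by
      intro k
      have hlt : φ k < φ (k + 1) := hφ (Nat.lt_succ_self k)
      rw [← hadd _ _ _ (by omega) (by omega), norm_mul, norm_mul, norm_pow]
      have b₁ := hb (φ (k + 1) + 1 + (φ k + 1)) (by omega)
      have b₂ := hb (φ (k + 1) + 1 - (φ k + 1)) (by omega)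
      gcongr
    have h₃ : Filter.Tendsto
        (fun k => (‖X‖ + c) * (‖X‖ + c) * ‖x (φ (k + 1) + 1) - x (φ k + 1)‖ ^ 2)
        Filter.atTop (nhds 0) := by
      have := ((hlim₂.sub hlim₁).norm.pow 2).const_mul ((‖X‖ + c) * (‖X‖ + c))
      rwa [sub_self, norm_zero, zero_pow two_ne_zero, mul_zero] at this
    exact tendsto_nhds_unique h₁ (squeeze_zero_norm h₂ h₃)
  apply hΔ
  -- The coefficients of the form at `(x₀, x₀)` are the numerator and the denominator of the
  -- duplication formula; their resultant is the multiple `hΔ` of the discriminant.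
  have h₀ := hform 0
  have h₁ := hform 1
  simp only [biquadraticForm] at h₀ h₁
  linear_combination 4 * (3 * x₀ ^ 2 + 4 * A) * h₀ -
    (3 * x₀ ^ 3 - 5 * A * x₀ - 27 * B) * (h₀ - h₁)

/-- A point of infinite order over a locally compact field has multiples arbitrarily close to
infinity. -/
lemma exists_lt_norm_xCoord_nsmul {K : Type*} [NormedField K] [ProperSpace K] [DecidableEq K]
    {W : WeierstrassCurve K} (ha₁ : W.a₁ = 0) (ha₂ : W.a₂ = 0) (ha₃ : W.a₃ = 0)
    (hΔ : 4 * (4 * W.a₄ ^ 3 + 27 * W.a₆ ^ 2) ≠ 0) {P : W.toAffine.Point}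
    (hinf : ¬ IsOfFinAddOrder P) (c : ℝ) : ∃ n : ℕ, 1 ≤ n ∧ c < ‖(n • P).xCoord‖ := by
  refine exists_lt_norm_of_biquadraticForm (x := fun n => (n • P).xCoord) hΔ
    (fun m n X hn hmn => ?_) c
  have hmul := nsmul_ne_zero_of_not_isOfFinAddOrder hinf
  have e := xCoord_add_sub ha₁ ha₂ ha₃ (hmul m (by omega)) (hmul n hn)
    (xCoord_nsmul_ne hinf (by omega) hn (by omega)) X
  rwa [← add_nsmul, show m • P - n • P = (m - n) • P by
    rw [sub_eq_iff_eq_add, ← add_nsmul]; congr 1; omega] at e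

variable {p : ℕ} [Fact p.Prime]

/-- Points sufficiently close to infinity reduce to infinity on any minimal model. -/
lemma exists_norm_bound_onIdentityComponent (W : WeierstrassCurve ℚ_[p]) :
    ∃ c : ℝ, ∀ Q : W.toAffine.Point, c < ‖Q.xCoord‖ → OnIdentityComponent p W Q := by
  obtain ⟨C, hC⟩ := W.exists_isMinimal ℤ_[p]
  refine ⟨‖C.r‖ + ‖(C.u : ℚ_[p])‖ ^ 2, fun Q hQ => ?_⟩
  rcases Q with _ | ⟨x, y, h⟩
  · trivial
  have hu : (C.u : ℚ_[p]) ≠ 0 := C.u.ne_zero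
  refine ⟨C, hC, (x - C.r) / C.u ^ 2,
    (y - C.u ^ 2 * C.s * ((x - C.r) / C.u ^ 2) - C.t) / C.u ^ 3, ?_, ?_, Or.inl ?_⟩
  · field_simp; ring
  · field_simp; ring
  · have hx : ‖C.r‖ + ‖(C.u : ℚ_[p])‖ ^ 2 < ‖x‖ := hQ
    have := norm_sub_norm_le x C.r
    rw [norm_div, norm_pow, one_lt_div (by positivity)]
    linarith

lemma hasGoodReduction_of_isUnit_Δ (W : WeierstrassCurve ℤ_[p]) (hW : IsUnit W.Δ) :
    HasGoodReduction ℤ_[p] (W⁄ℚ_[p]) := by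
  have hint : IsIntegral ℤ_[p] (W⁄ℚ_[p]) := ⟨W, rfl⟩
  have hval : IsDedekindDomain.HeightOneSpectrum.valuation ℚ_[p]
      (IsDiscreteValuationRing.maximalIdeal ℤ_[p]) (W⁄ℚ_[p]).Δ = 1 := by
    rw [show (W⁄ℚ_[p]).Δ = algebraMap ℤ_[p] ℚ_[p] W.Δ from map_Δ W _]
    refine le_antisymm (IsDedekindDomain.HeightOneSpectrum.valuation_le_one _ _) (not_lt.mp ?_)
    rw [IsDedekindDomain.HeightOneSpectrum.valuation_lt_one_iff_mem]
    exact fun hmem => (IsLocalRing.mem_maximalIdeal _).mp hmem hW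
  have hmin : IsMinimal ℤ_[p] (W⁄ℚ_[p]) := by
    refine ⟨⟨by simpa using hint, fun C _ _ => ?_⟩⟩
    beta_reduce
    rw [one_smul, ← Subtype.coe_le_coe,
      (valuation_Δ_aux_eq_of_isIntegral ℤ_[p] (W⁄ℚ_[p])).trans hval]
    exact (valuation_Δ_aux ℤ_[p] (C • W⁄ℚ_[p])).2
  exact ⟨hval⟩

lemma onIdentityComponent_of_isUnit_Δ (W : WeierstrassCurve ℤ_[p]) (hW : IsUnit W.Δ)
    (a b : ℤ_[p]) {V : WeierstrassCurve ℚ_[p]} (hV : V = W⁄ℚ_[p]) {x y : ℚ_[p]} (hx : x = a)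
    (hy : y = b) (h : V.toAffine.Nonsingular x y) : OnIdentityComponent p V (some x y h) := by
  subst hV hx hy
  have hgood := hasGoodReduction_of_isUnit_Δ W hW
  have hmin : IsMinimal ℤ_[p] (W⁄ℚ_[p]) := hgood.toIsMinimal
  have hred : HasNonsingularReduction p (W⁄ℚ_[p]) a b := by
    refine Or.inr ⟨a, b, rfl, rfl, ?_⟩
    have hell := (hasGoodReduction_iff_isElliptic_reduction ℤ_[p]).mp hgood
    rw [← equation_iff_nonsingular]
    have : (integralModel ℤ_[p] (W⁄ℚ_[p])).toAffine.Equation a b := by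
      rw [← map_equation _ (IsFractionRing.injective ℤ_[p] ℚ_[p])]
      exact (congrArg (fun V : WeierstrassCurve ℚ_[p] => V.toAffine.Equation (a : ℚ_[p]) b)
        (baseChange_integralModel_eq ℤ_[p] (W⁄ℚ_[p]))).mpr h.1
    exact this.map (IsLocalRing.residue ℤ_[p])
  have key : ∀ V : WeierstrassCurve ℚ_[p], V = W⁄ℚ_[p] →
      ∃ _ : V.IsMinimal ℤ_[p], HasNonsingularReduction p V a b := by
    rintro _ rfl
    exact ⟨hmin, hred⟩
  obtain ⟨hmin', hred'⟩ := key ((1 : VariableChange ℚ_[p]) • (W⁄ℚ_[p])) (one_smul _ _)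
  exact ⟨1, hmin', a, b, by simp [VariableChange.one_def], by simp [VariableChange.one_def], hred'⟩

end Component

section ComponentLcm

open WeierstrassCurve WeierstrassCurve.Affine WeierstrassCurve.Affine.Point

variable {A B : ℤ}

lemma shortWeierstrass_Δ (A B : ℤ) :
    (shortWeierstrass A B).Δ = -4 * (4 * (4 * A ^ 3 + 27 * B ^ 2)) := by
  simp only [shortWeierstrass, WeierstrassCurve.Δ, b₂, b₄, b₆, b₈]
  ring

lemma componentOrder_pos (hE : (shortWeierstrass A B).Δ ≠ 0)
    {P : ((shortWeierstrass A B)⁄ℚ).toAffine.Point} (hinf : ¬ IsOfFinAddOrder P)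
    (p : ℕ) [Fact p.Prime] : 0 < componentOrder (shortWeierstrass A B) P p := by
  classical
  set W := (shortWeierstrass A B)⁄ℚ_[p]
  obtain ⟨c, hc⟩ := exists_norm_bound_onIdentityComponent W
  set Q : W.toAffine.Point := Point.baseChange (W' := shortWeierstrass A B) ℚ ℚ_[p] P
  have hQ : ¬ IsOfFinAddOrder Q := by
    intro h
    exact hinf ((Point.map_injective (W' := shortWeierstrass A B)
      (Algebra.ofId ℚ ℚ_[p])).isOfFinAddOrder_iff.mp h)
  have hΔ : 4 * (4 * W.a₄ ^ 3 + 27 * W.a₆ ^ 2) ≠ 0 := by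
    rw [shortWeierstrass_Δ] at hE
    have : 4 * (4 * A ^ 3 + 27 * B ^ 2) ≠ 0 := right_ne_zero_of_mul hE
    simp only [W, WeierstrassCurve.baseChange, shortWeierstrass, WeierstrassCurve.map, eq_intCast]
    exact_mod_cast this
  obtain ⟨n, hn, hlt⟩ := exists_lt_norm_xCoord_nsmul (W := W) (by simp [W, shortWeierstrass])
    (by simp [W, shortWeierstrass]) (by simp [W, shortWeierstrass]) hΔ hQ c
  refine addOrderOf_pos_iff.mpr (isOfFinAddOrder_iff_nsmul_eq_zero.mpr ⟨n, hn, ?_⟩)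
  rw [← QuotientAddGroup.mk_nsmul, QuotientAddGroup.eq_zero_iff]
  exact AddSubgroup.subset_closure (hc _ hlt)

lemma componentOrder_eq_one {a b : ℤ}
    (hP : ((shortWeierstrass A B)⁄ℚ).toAffine.Nonsingular (a : ℚ) (b : ℚ))
    (p : ℕ) [Fact p.Prime] (hp : ¬ (p : ℤ) ∣ (shortWeierstrass A B).Δ) :
    componentOrder (shortWeierstrass A B) (some (a : ℚ) (b : ℚ) hP) p = 1 := by
  classical
  refine AddMonoid.addOrderOf_eq_one_iff.mpr ?_
  rw [QuotientAddGroup.eq_zero_iff]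
  refine AddSubgroup.subset_closure ?_
  have hunit : IsUnit ((shortWeierstrass A B)⁄ℤ_[p]).Δ := by
    rw [show ((shortWeierstrass A B)⁄ℤ_[p]).Δ = algebraMap ℤ ℤ_[p] (shortWeierstrass A B).Δ from
      map_Δ _ _, PadicInt.isUnit_iff]
    refine le_antisymm (PadicInt.norm_le_one _) (not_lt.mp ?_)
    rwa [eq_intCast, PadicInt.norm_intCast_lt_one_iff]
  rw [Set.mem_ofPred_eq,
    show Point.baseChange (W' := shortWeierstrass A B) ℚ ℚ_[p] (some (a : ℚ) (b : ℚ) hP) = _ from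
    map_some _ hP]
  refine onIdentityComponent_of_isUnit_Δ ((shortWeierstrass A B)⁄ℤ_[p]) hunit a b ?_ ?_ ?_ _
  · ext <;> simp
  · simp
  · simp

/-- The common multiples in the definition of `componentLcm` exist, so that it is not the junk
value `0`. -/
lemma componentLcm_pos (hE : (shortWeierstrass A B).Δ ≠ 0) {a b : ℤ}
    (hP : ((shortWeierstrass A B)⁄ℚ).toAffine.Nonsingular (a : ℚ) (b : ℚ))
    (hinf : ¬ IsOfFinAddOrder (some (a : ℚ) (b : ℚ) hP)) :
    0 < componentLcm (shortWeierstrass A B) (some (a : ℚ) (b : ℚ) hP) := by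
  obtain ⟨P, hP'⟩ : ∃ P, P = some (a : ℚ) (b : ℚ) hP := ⟨_, rfl⟩
  have hone := fun (p : ℕ) [Fact p.Prime] => componentOrder_eq_one hP p
  have hpos := fun (p : ℕ) [Fact p.Prime] => componentOrder_pos hE hinf p
  rw [← hP'] at hpos hone ⊢
  clear hP'
  let r : ℕ → ℕ := fun p =>
    if hp : p.Prime then @componentOrder (shortWeierstrass A B) P p ⟨hp⟩ else 1
  have hr : ∀ (p : ℕ) [hp : Fact p.Prime], r p = componentOrder (shortWeierstrass A B) P p :=
    fun p hp => dif_pos hp.out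
  have hne : {m : ℕ | 0 < m ∧ ∀ (p : ℕ) [Fact p.Prime],
      componentOrder (shortWeierstrass A B) P p ∣ m}.Nonempty := by
    refine ⟨∏ p ∈ (shortWeierstrass A B).Δ.natAbs.primeFactors, r p, ?_, fun p hp => ?_⟩
    · refine Finset.prod_pos fun p hp => ?_
      have : Fact p.Prime := ⟨Nat.prime_of_mem_primeFactors hp⟩
      rw [hr p]
      exact hpos p
    · by_cases hdvd : (p : ℤ) ∣ (shortWeierstrass A B).Δ
      · rw [← hr p]
        exact Finset.dvd_prod_of_mem r (Nat.mem_primeFactors.mpr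
          ⟨hp.out, Int.natCast_dvd.mp hdvd, Int.natAbs_ne_zero.mpr hE⟩)
      · rw [hone p hdvd]
        exact one_dvd _
  exact (Nat.sInf_mem hne).1

end ComponentLcm

/-! ### Comparison of logarithms -/

/-- The denominator of the `x`-coordinate of a rational point is a square. -/
lemma exists_den_eq_sq {A B : ℤ} {x y : ℚ} (h : y ^ 2 = x ^ 3 + A * x + B) :
    ∃ D : ℤ, 0 < D ∧ (x.den : ℤ) = D ^ 2 := by
  have hs : (0 : ℤ) < x.den := by exact_mod_cast x.pos
  have hden : (x.den : ℚ) ≠ 0 := by exact_mod_cast x.den_ne_zero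
  have hcop : IsCoprime (x.den : ℤ) (x.num ^ 3 + x.den * (A * x.num * x.den + B * x.den ^ 2)) :=
    ((Rat.isCoprime_num_den x).pow_left (m := 3)).symm.add_mul_left_right _
  have hnum : (x.num : ℚ) = x * x.den := by
    have := Rat.num_div_den x
    field_simp at this
    linear_combination this
  have hsq : IsSquare (x.den * (x.num ^ 3 + x.den * (A * x.num * x.den + B * x.den ^ 2)) : ℤ) := by
    rw [← Rat.isSquare_intCast_iff]
    refine ⟨y * x.den ^ 2, ?_⟩
    push_cast
    rw [hnum]
    linear_combination -(x.den : ℚ) ^ 4 * h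
  obtain ⟨c, hc⟩ := hsq
  obtain ⟨D, hD | hD⟩ := Int.sq_of_isCoprime hcop (hc.trans (sq c).symm)
  · refine ⟨|D|, abs_pos.mpr ?_, by rw [sq_abs, hD]⟩
    rintro rfl
    rw [hD] at hs
    simp at hs
  · nlinarith [sq_nonneg D]

lemma XCoordLowestTerms.den_eq {W : WeierstrassCurve ℚ} {Q : W.toAffine.Point} {a d : ℤ}
    (h : XCoordLowestTerms Q a d) : (Q.xCoord.den : ℤ) = d ^ 2 := by
  obtain ⟨hd, hcop, x, y, hxy, rfl, hx⟩ := h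
  have := Rat.den_div_eq_of_coprime (a := a) (b := d ^ 2) (by positivity)
    (Int.isCoprime_iff_gcd_eq_one.mp hcop.pow_right)
  push_cast at this
  rw [← this, ← hx]
  rfl

theorem mainTheorem9 (A B : ℤ) (hE : (shortWeierstrass A B).Δ ≠ 0) (a b : ℤ)
    (hP : ((shortWeierstrass A B)⁄ℚ).toAffine.Nonsingular (a : ℚ) (b : ℚ))
    (hinf : ¬ IsOfFinAddOrder (WeierstrassCurve.Affine.Point.some (a : ℚ) (b : ℚ) hP))
    (n : ℕ) (hn : 1 ≤ n) :
    divisionValue (shortWeierstrass A B) a b n ≠ 0 ∧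
    (∃ An Dn : ℤ,
      XCoordLowestTerms (n • WeierstrassCurve.Affine.Point.some (a : ℚ) (b : ℚ) hP) An Dn) ∧
    ∀ An Dn : ℤ,
      XCoordLowestTerms (n • WeierstrassCurve.Affine.Point.some (a : ℚ) (b : ℚ) hP) An Dn →
      Real.log Dn ≤ Real.log |(divisionValue (shortWeierstrass A B) a b n : ℝ)| ∧
      Real.log |(divisionValue (shortWeierstrass A B) a b n : ℝ)| ≤
        Real.log Dn +
          (n : ℝ) ^ 2 *
            (componentLcm (shortWeierstrass A B)
              (WeierstrassCurve.Affine.Point.some (a : ℚ) (b : ℚ) hP) : ℝ) ^ 2 *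
            Real.log |((shortWeierstrass A B).Δ : ℝ)| := by
  have hM := componentLcm_pos hE hP hinf
  set M := componentLcm (shortWeierstrass A B) (WeierstrassCurve.Affine.Point.some (a : ℚ) b hP)
  have hx := isXCoordSequence_nsmul (W := (shortWeierstrass A B)⁄ℚ) (by simp [shortWeierstrass])
    (by simp [shortWeierstrass]) (by simp [shortWeierstrass]) hP hinf
  have h₄ : ((shortWeierstrass A B)⁄ℚ).a₄ = A := by simp [shortWeierstrass]
  have h₆ : ((shortWeierstrass A B)⁄ℚ).a₆ = B := by simp [shortWeierstrass]
  rw [h₄, h₆] at hx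
  have hx₁ : (1 • WeierstrassCurve.Affine.Point.some (a : ℚ) b hP).xCoord = a := by
    rw [one_nsmul]; rfl
  have hh := cast_divisionValue_eq_sequenceOfXCoords hx hx₁
  have hne : divisionValue (shortWeierstrass A B) a b n ≠ 0 := by
    have := sequenceOfXCoords_ne_zero hx n hn
    rw [← hh] at this
    exact_mod_cast this
  have hN : 4 * (4 * A ^ 3 + 27 * B ^ 2) ≠ 0 := by
    rw [shortWeierstrass_Δ] at hE
    exact right_ne_zero_of_mul hE
  have hbound := den_le_sq_and_sq_le hN hx hx₁ hh (n - 1)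
  rw [Nat.sub_add_cancel hn] at hbound
  refine ⟨hne, ?_, fun An Dn hD => ?_⟩
  · have h0 := nsmul_ne_zero_of_not_isOfFinAddOrder hinf n hn
    rcases hQ : n • WeierstrassCurve.Affine.Point.some (a : ℚ) b hP with _ | ⟨x, y, hxy⟩
    · exact absurd hQ h0
    have e := (WeierstrassCurve.Affine.equation_iff _ _).mp hxy.1
    obtain ⟨D, hD, hden⟩ := exists_den_eq_sq (A := A) (B := B) (x := x) (y := y) (by
      simpa [shortWeierstrass] using e)
    have hcop := Rat.isCoprime_num_den x
    rw [hden] at hcop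
    refine ⟨x.num, D, hD, (IsCoprime.pow_right_iff two_pos).mp hcop, x, y, hxy, rfl, ?_⟩
    have : (x.den : ℚ) = (D : ℚ) ^ 2 := by exact_mod_cast hden
    rw [← this, Rat.num_div_den]
  · rw [hD.den_eq] at hbound
    obtain ⟨hlow, hup⟩ := hbound
    have hDpos : (0 : ℝ) < Dn := by exact_mod_cast hD.1
    set h := divisionValue (shortWeierstrass A B) a b n
    set N := 4 * (4 * A ^ 3 + 27 * B ^ 2) with hNdef
    have hhpos : (0 : ℝ) < |(h : ℝ)| := abs_pos.mpr (by exact_mod_cast hne)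
    have hNpos : (1 : ℝ) ≤ |(N : ℝ)| := by exact_mod_cast Int.one_le_abs hN
    have hΔ : |((shortWeierstrass A B).Δ : ℝ)| = 4 * |(N : ℝ)| := by
      rw [shortWeierstrass_Δ, ← hNdef]
      push_cast
      rw [abs_mul]
      norm_num
    have hNΔ : Real.log |(N : ℝ)| ≤ Real.log |((shortWeierstrass A B).Δ : ℝ)| :=
      Real.log_le_log (by linarith) (by rw [hΔ]; linarith)
    have hN0 : 0 ≤ Real.log |(N : ℝ)| := Real.log_nonneg hNpos
    have hlow' : (Dn : ℝ) ≤ |(h : ℝ)| := by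
      refine (abs_of_pos hDpos).symm.le.trans (sq_le_sq.mp ?_)
      exact_mod_cast hlow
    have hup' : |(h : ℝ)| ^ 2 ≤ |(N : ℝ)| ^ n ^ 2 * (Dn : ℝ) ^ 2 := by
      rw [sq_abs]
      exact_mod_cast hup
    have hlog := Real.log_le_log (by positivity) hup'
    rw [Real.log_mul (by positivity) (by positivity), Real.log_pow, Real.log_pow,
      Real.log_pow] at hlog
    push_cast at hlog
    refine ⟨Real.log_le_log hDpos hlow', ?_⟩
    have hM1 : (1 : ℝ) ≤ (M : ℝ) ^ 2 := one_le_pow₀ (by exact_mod_cast hM)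
    have h₁ : (n : ℝ) ^ 2 * Real.log |(N : ℝ)| ≤
        (n : ℝ) ^ 2 * (M : ℝ) ^ 2 * Real.log |((shortWeierstrass A B).Δ : ℝ)| := by
      have : (n : ℝ) ^ 2 ≤ (n : ℝ) ^ 2 * (M : ℝ) ^ 2 := le_mul_of_one_le_right (by positivity) hM1
      exact mul_le_mul this hNΔ hN0 (by positivity)
    have h₂ : 0 ≤ (n : ℝ) ^ 2 * Real.log |(N : ℝ)| := by positivity
    linarith
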